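/- For $w\in\mathbb C$ and $r>0$ let $$\Omega(w,r)=\bigl\{z\in\mathbb C : \sqrt{|z-w|\,|z-\overline w|}<r\bigr\},$$ whose boundary $\partial\Omega(w,r)$ is a Cassini oval with foci $w,\overline w$ (a circle if $w\in\mathbb R$), and let $\mathrm{length}$ denote one-dimensional Hausdorff measure in the plane. Then the supremum $$\Theta:=\sup_{w\in\mathbb C,\ r>0}\ \frac{\mathrm{length}(\partial\Omega(w,r))}{2\pi\left(\sqrt{r^2+|\operatorname{Im} w|^2}-|\operatorname{Im} w|\right)}$$ is finite, and $$\Theta=\frac{1+\sqrt2}{2}\,\frac{\Gamma(1/4)^2}{\pi^{3/2}}<2.85 .$$ Moreover, the supremum is attained at the Bernoulli lemniscate: for every $w\in\mathbb C\setminus\mathbb R$ and $r=|\operatorname{Im} w|$, the set $\partial\Omega(w,r)$ is the Bernoulli lemniscate $\{z : |z-w|\,|z-\overline w|=(|w-\overline w|/2)^2\}$ with foci $w,\overline w$, and the quotient above equals $\Theta$. -/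

import Mathlib

open MeasureTheory
open scoped ENNReal ComplexConjugate

/-- The characteristic polynomial `Δ_w(z) = (z - w) (z - conj w)`. -/
noncomputable def cassiniDelta (w z : ℂ) : ℂ := (z - w) * (z - conj w)

/-- The Cassini pseudo-metric on `ℂ`. -/
noncomputable def cassiniDist (z w : ℂ) : ℝ := Real.sqrt ‖cassiniDelta w z‖

/-- The open ball of the Cassini pseudo-metric; its boundary is a Cassini oval with foci
`w` and `conj w` (a circle if `w` is real). -/
def cassiniBall (w : ℂ) (r : ℝ) : Set ℂ := {z | cassiniDist z w < r}

/-- The length of a planar set: its one-dimensional Hausdorff measure, which Mathlib normalizes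
so that it is arc length on rectifiable arcs. -/
noncomputable def setLength (S : Set ℂ) : ℝ≥0∞ := Measure.hausdorffMeasure 1 S

/-- `length(∂Ω(w,r)) / (2π (√(r² + |Im w|²) - |Im w|))`, with values in `[0, ∞]`.
The denominator is positive for `r > 0`. -/
noncomputable def cassiniRatio (w : ℂ) (r : ℝ) : ℝ≥0∞ :=
  setLength (frontier (cassiniBall w r)) /
    ENNReal.ofReal (2 * Real.pi * (Real.sqrt (r ^ 2 + |w.im| ^ 2) - |w.im|))

/-- The supremum `Θ` of the ratios over all `w ∈ ℂ` and `r > 0`, taken in `[0, ∞]`. -/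
noncomputable def cassiniTheta : ℝ≥0∞ := ⨆ (w : ℂ) (r : ℝ) (_ : 0 < r), cassiniRatio w r

/-- The Bernoulli lemniscate with foci `a` and `b`: the locus of the points whose distances from
the foci have product equal to the square of half the focal distance. -/
def bernoulliLemniscate (a b : ℂ) : Set ℂ := {z | dist z a * dist z b = (dist a b / 2) ^ 2}

/-! ### Length of injective C¹ curves as one-dimensional Hausdorff measure. -/

section ArcLength

open Set Filter Topology

variable {E : Type*} [NormedAddCommGroup E] [NormedSpace ℝ E]

/-! Put `a = |Im w|²` and `s = r²`. After translation by `Re w` the oval lies in the level set `|ζ²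
+ a| = s`. Up to finitely many points this set consists of the two arcs `ζ = ±i (a + s
e^{iθ})^{1/2}`, each with speed `(s/2) |a + s e^{iθ}|^{-1/2}`, so its length is `s ∫ |a + s
e^{iθ}|^{-1/2} dθ` (`hausdorffMeasure_level_set`). Since `s = (√(s+a) - √a)(√(s+a) + √a)`, the
quotient built from this length is `(√(s+a) + √a) ∫ |a + s e^{iθ}|^{-1/2} dθ / 2π`.

With `m = max a s` and `t = min a s / m`, the modulus is `m |1 + t e^{iθ}|`, because `a` and `s`
play symmetric roles in it. The powers of `m` cancel and two inequalities remain. One is `√(s+a) +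
√a ≤ (1 + √2) √m`. The other is that circle means of `|1 + z|^{-1/2}` grow with the radius up to the
unit circle (`integral_norm_rpow_mono`, `integral_norm_rpow_le_unit`). Both are equalities when `a =
s > 0`, which is the lemniscate.

The extremal mean is a Beta integral `B(1/2, 1/4)`, and the reflection formula turns it into
`Γ(1/4)²`. The decimal bound comes from the recursion and log-convexity of Gamma. The upper estimate
only needs the frontier to lie in the level set; for the lemniscate the two sets are shown to be
equal. -/

/-- On a convex set where the derivative is `ε`-close to `v`, a curve is `ε`-close to the linear map
with velocity `v`. -/
theorem norm_sub_sub_smul_le_of_deriv_near {f f' : ℝ → E} {U : Set ℝ} (hU : Convex ℝ U)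
    (hf : ∀ x ∈ U, HasDerivAt f (f' x) x) {v : E} {ε : ℝ} (hv : ∀ x ∈ U, ‖f' x - v‖ ≤ ε)
    {x y : ℝ} (hx : x ∈ U) (hy : y ∈ U) :
    ‖f x - f y - (x - y) • v‖ ≤ ε * ‖x - y‖ := by
  have h := hU.norm_image_sub_le_of_norm_hasDerivWithin_le
    (f := fun t => f t - t • v) (f' := fun t => f' t - v) (C := ε)
    (fun t ht => by
      have h1 := (hf t ht).sub ((hasDerivAt_id t).smul_const v)
      rw [one_smul] at h1
      exact h1.hasDerivWithinAt) hv hy hx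
  convert h using 2
  rw [sub_smul]; abel

variable [MeasurableSpace E] [BorelSpace E]

/-- The curve is Lipschitz with constant `‖v‖ + ε` on `U`. -/
theorem hausdorffMeasure_image_le_of_deriv_near {f f' : ℝ → E} {U : Set ℝ} (hU : Convex ℝ U)
    (hf : ∀ x ∈ U, HasDerivAt f (f' x) x) {v : E} {ε : ℝ} (hε : 0 ≤ ε)
    (hv : ∀ x ∈ U, ‖f' x - v‖ ≤ ε) {p : Set ℝ} (hp : p ⊆ U) :
    Measure.hausdorffMeasure 1 (f '' p) ≤ ENNReal.ofReal (‖v‖ + ε) * volume p := by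
  have hL : LipschitzOnWith (Real.toNNReal (‖v‖ + ε)) f p := by
    refine LipschitzOnWith.of_dist_le_mul fun x hx y hy => ?_
    rw [Real.coe_toNNReal _ (by positivity), dist_eq_norm, dist_eq_norm]
    have h := norm_sub_sub_smul_le_of_deriv_near hU hf hv (hp hx) (hp hy)
    have h2 := norm_le_norm_add_norm_sub' (f x - f y) ((x - y) • v)
    rw [norm_smul] at h2
    linarith
  have := hL.hausdorffMeasure_image_le (d := 1) zero_le_one
  rw [hausdorffMeasure_real] at this
  simpa [ENNReal.ofReal] using this

/-- When `ε < ‖v‖` the curve expands distances by at least `‖v‖ - ε`, so it is injective on `p` with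
Lipschitz inverse; otherwise the left side vanishes. -/
theorem le_hausdorffMeasure_image_of_deriv_near {f f' : ℝ → E} {U : Set ℝ} (hU : Convex ℝ U)
    (hf : ∀ x ∈ U, HasDerivAt f (f' x) x) {v : E} {ε : ℝ}
    (hv : ∀ x ∈ U, ‖f' x - v‖ ≤ ε) {p : Set ℝ} (hp : p ⊆ U) :
    ENNReal.ofReal (‖v‖ - ε) * volume p ≤ Measure.hausdorffMeasure 1 (f '' p) := by
  rcases le_or_gt (‖v‖ - ε) 0 with h0 | h0
  · simp [ENNReal.ofReal_of_nonpos h0]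
  obtain ⟨c, hc⟩ : ∃ c : NNReal, (c : ℝ) = ‖v‖ - ε := ⟨_, Real.coe_toNNReal _ h0.le⟩
  rw [← hc] at h0 ⊢
  rw [ENNReal.ofReal_coe_nnreal]
  have hc0 : c ≠ 0 := by
    rintro rfl
    simp at h0
  have key : ∀ x ∈ p, ∀ y ∈ p, c * dist x y ≤ dist (f x) (f y) := by
    intro x hx y hy
    rw [dist_eq_norm, dist_eq_norm]
    have h := norm_sub_sub_smul_le_of_deriv_near hU hf hv (hp hx) (hp hy)
    have h2 := norm_le_norm_add_norm_sub (f x - f y) ((x - y) • v)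
    rw [norm_smul] at h2
    rw [hc]
    linarith
  have hinj : InjOn f p := by
    intro x hx y hy hxy
    have := key x hx y hy
    rw [hxy, dist_self] at this
    have h3 : dist x y ≤ 0 := by
      by_contra! h4
      have : 0 < (c : ℝ) * dist x y := mul_pos h0 h4
      linarith
    exact dist_le_zero.1 h3
  have hL : LipschitzOnWith c⁻¹ (Function.invFunOn f p) (f '' p) := by
    refine LipschitzOnWith.of_dist_le_mul ?_
    rintro _ ⟨x, hx, rfl⟩ _ ⟨y, hy, rfl⟩
    rw [hinj.leftInvOn_invFunOn hx, hinj.leftInvOn_invFunOn hy, NNReal.coe_inv,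
      inv_mul_eq_div, le_div_iff₀ h0, mul_comm]
    exact key x hx y hy
  have := hL.hausdorffMeasure_image_le (d := 1) zero_le_one
  rw [hinj.leftInvOn_invFunOn.image_image, hausdorffMeasure_real] at this
  calc (c : ℝ≥0∞) * volume p
      ≤ c * ((c⁻¹ : NNReal) * Measure.hausdorffMeasure 1 (f '' p)) := by
        gcongr; simpa using this
    _ = _ := by
        rw [← mul_assoc, ← ENNReal.coe_mul, mul_inv_cancel₀ hc0]; simp

/-- The length of an injective `C¹` curve is the integral of its speed. -/
theorem hausdorffMeasure_image_eq_lintegral_enorm_deriv {f f' : ℝ → E} {a b : ℝ}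
    (hf : ∀ x ∈ Ioo a b, HasDerivAt f (f' x) x) (hf' : ContinuousOn f' (Ioo a b))
    (hinj : InjOn f (Ioo a b)) :
    Measure.hausdorffMeasure 1 (f '' Ioo a b) = ∫⁻ x in Ioo a b, ‖f' x‖ₑ := by
  have hfc : ContinuousOn f (Ioo a b) := fun x hx => (hf x hx).continuousAt.continuousWithinAt
  -- Both sides agree up to `2 ε (b - a)`.
  have main : ∀ ε : NNReal, 0 < ε →
      Measure.hausdorffMeasure 1 (f '' Ioo a b) ≤
        (∫⁻ x in Ioo a b, ‖f' x‖ₑ) + 2 * ε * volume (Ioo a b) ∧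
      (∫⁻ x in Ioo a b, ‖f' x‖ₑ) ≤
        Measure.hausdorffMeasure 1 (f '' Ioo a b) + 2 * ε * volume (Ioo a b) := by
    intro ε hε
    -- Around each point the velocity oscillates by at most `ε`. Countably many such balls cover the
    -- interval and are then cut into disjoint measurable pieces.
    have hloc : ∀ x ∈ Ioo a b, ∃ δ > 0, Metric.ball x δ ⊆ Ioo a b ∧
        ∀ y ∈ Metric.ball x δ, ‖f' y - f' x‖ ≤ ε := by
      intro x hx
      have hcx : ContinuousAt f' x := hf'.continuousAt (isOpen_Ioo.mem_nhds hx)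
      obtain ⟨δ₁, h1, h1'⟩ := Metric.continuousAt_iff.1 hcx ε hε
      obtain ⟨δ₂, h2, h2'⟩ := Metric.isOpen_iff.1 isOpen_Ioo x hx
      refine ⟨min δ₁ δ₂, lt_min h1 h2,
        (Metric.ball_subset_ball (min_le_right _ _)).trans h2', fun y hy => ?_⟩
      have := h1' (lt_of_lt_of_le (Metric.mem_ball.1 hy) (min_le_left _ _))
      rw [dist_eq_norm] at this
      exact this.le
    choose! δ hδ hball hnear using hloc
    obtain ⟨t, htsub, htc, htU⟩ := TopologicalSpace.countable_cover_nhdsWithin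
      (s := Ioo a b) (f := fun x => Metric.ball x (δ x))
      (fun x hx => mem_nhdsWithin_of_mem_nhds (Metric.ball_mem_nhds x (hδ x hx)))
    rcases (Ioo a b).eq_empty_or_nonempty with hemp | hne
    · simp [hemp]
    have htne : t.Nonempty := by
      obtain ⟨x, hx⟩ := hne
      obtain ⟨y, hy, -⟩ := mem_iUnion₂.1 (htU hx)
      exact ⟨y, hy⟩
    obtain ⟨c, hc⟩ := htc.exists_eq_range htne
    have hcmem : ∀ n, c n ∈ Ioo a b := fun n => htsub (hc ▸ mem_range_self n)
    set V : ℕ → Set ℝ := fun n => Metric.ball (c n) (δ (c n)) with hV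
    set p : ℕ → Set ℝ := disjointed V with hp
    have hpV : ∀ n, p n ⊆ V n := fun n => disjointed_subset V n
    have hVs : ∀ n, V n ⊆ Ioo a b := fun n => hball _ (hcmem n)
    have hpm : ∀ n, MeasurableSet (p n) := fun n =>
      MeasurableSet.disjointed (fun k => Metric.isOpen_ball.measurableSet) n
    have hdis : Pairwise (Function.onFun Disjoint p) := disjoint_disjointed V
    have hUn : ⋃ n, p n = Ioo a b := by
      rw [hp, iUnion_disjointed]
      refine subset_antisymm (iUnion_subset hVs) fun x hx => ?_
      obtain ⟨y, hy, hxy⟩ := mem_iUnion₂.1 (htU hx)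
      rw [hc] at hy
      obtain ⟨n, rfl⟩ := hy
      exact mem_iUnion.2 ⟨n, hxy⟩
    have hint : (∫⁻ x in Ioo a b, ‖f' x‖ₑ) = ∑' n, ∫⁻ x in p n, ‖f' x‖ₑ := by
      rw [← hUn, lintegral_iUnion hpm hdis]
    have hvol : volume (Ioo a b) = ∑' n, volume (p n) := by
      rw [← hUn, measure_iUnion hdis hpm]
    -- Injectivity makes the images of the pieces disjoint and measurable, so their lengths add.
    have hH : Measure.hausdorffMeasure 1 (f '' Ioo a b) =
        ∑' n, Measure.hausdorffMeasure 1 (f '' p n) := by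
      rw [← hUn, image_iUnion, measure_iUnion]
      · intro m n hmn
        exact (hdis hmn).image hinj ((hpV m).trans (hVs m)) ((hpV n).trans (hVs n))
      · intro n
        have hs := (hpV n).trans (hVs n)
        exact (hpm n).image_of_continuousOn_injOn (hfc.mono hs) (hinj.mono hs)
    have hpiece : ∀ n,
        Measure.hausdorffMeasure 1 (f '' p n) ≤
          (∫⁻ x in p n, ‖f' x‖ₑ) + 2 * ε * volume (p n) ∧
        (∫⁻ x in p n, ‖f' x‖ₑ) ≤
          Measure.hausdorffMeasure 1 (f '' p n) + 2 * ε * volume (p n) := by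
      intro n
      have hconv : Convex ℝ (V n) := convex_ball _ _
      have hd : ∀ x ∈ V n, HasDerivAt f (f' x) x := fun x hx => hf x (hVs n hx)
      have hn : ∀ x ∈ V n, ‖f' x - f' (c n)‖ ≤ ε := hnear _ (hcmem n)
      have hup := hausdorffMeasure_image_le_of_deriv_near hconv hd ε.coe_nonneg hn (hpV n)
      have hlo := le_hausdorffMeasure_image_of_deriv_near hconv hd hn (hpV n)
      -- One `ε` is lost between the length and `‖v‖ * volume`, another between `‖v‖ * volume` and
      -- the integral of the speed.
      set v := f' (c n)
      have e1 : ENNReal.ofReal (‖v‖ + ε) = ENNReal.ofReal ‖v‖ + ε := by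
        rw [ENNReal.ofReal_add (norm_nonneg _) ε.coe_nonneg, ENNReal.ofReal_coe_nnreal]
      have e2 : ENNReal.ofReal ‖v‖ ≤ ENNReal.ofReal (‖v‖ - ε) + ε := by
        rw [← ENNReal.ofReal_coe_nnreal (p := ε)]
        refine le_trans (ENNReal.ofReal_le_ofReal ?_) ENNReal.ofReal_add_le
        linarith
      have i1 : (∫⁻ x in p n, ‖f' x‖ₑ) ≤ (ENNReal.ofReal ‖v‖ + ε) * volume (p n) := by
        rw [← setLIntegral_const]
        refine setLIntegral_mono' (hpm n) fun x hx => ?_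
        rw [← e1, ← ofReal_norm]
        refine ENNReal.ofReal_le_ofReal ?_
        have := norm_le_norm_add_norm_sub' (f' x) v
        have h3 := hn x (hpV n hx)
        linarith
      have i2 : ENNReal.ofReal ‖v‖ * volume (p n) ≤
          (∫⁻ x in p n, ‖f' x‖ₑ) + ε * volume (p n) := by
        rw [← setLIntegral_const, ← setLIntegral_const (p n) (ε : ℝ≥0∞),
          ← lintegral_add_right _ measurable_const]
        refine setLIntegral_mono' (hpm n) fun x hx => ?_
        rw [← ENNReal.ofReal_coe_nnreal (p := ε), ← ofReal_norm,
          ← ENNReal.ofReal_add (norm_nonneg _) ε.coe_nonneg]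
        refine ENNReal.ofReal_le_ofReal ?_
        have := norm_le_norm_add_norm_sub (f' x) v
        have h3 := hn x (hpV n hx)
        linarith
      constructor
      · calc _ ≤ (ENNReal.ofReal ‖v‖ + ε) * volume (p n) := e1 ▸ hup
          _ = ENNReal.ofReal ‖v‖ * volume (p n) + ε * volume (p n) := add_mul _ _ _
          _ ≤ (∫⁻ x in p n, ‖f' x‖ₑ) + ε * volume (p n) + ε * volume (p n) := by gcongr
          _ = _ := by ring
      · calc _ ≤ (ENNReal.ofReal ‖v‖ + ε) * volume (p n) := i1
          _ ≤ (ENNReal.ofReal (‖v‖ - ε) + ε + ε) * volume (p n) := by gcongr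
          _ = ENNReal.ofReal (‖v‖ - ε) * volume (p n) + 2 * ε * volume (p n) := by ring
          _ ≤ _ := by gcongr
    rw [hint, hvol, hH, ← ENNReal.tsum_mul_left, ← ENNReal.tsum_add, ← ENNReal.tsum_add]
    exact ⟨ENNReal.tsum_le_tsum fun n => (hpiece n).1, ENNReal.tsum_le_tsum fun n => (hpiece n).2⟩
  have lim : ∀ A : ℝ≥0∞, Tendsto (fun ε : NNReal => A + 2 * (ε : ℝ≥0∞) * volume (Ioo a b))
      (𝓝[>] 0) (𝓝 A) := by
    intro A
    have hcont : Continuous fun ε : NNReal => A + 2 * (ε : ℝ≥0∞) * volume (Ioo a b) := by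
      have h1 : Continuous fun ε : NNReal => 2 * (ε : ℝ≥0∞) :=
        (ENNReal.continuous_const_mul (by simp)).comp ENNReal.continuous_coe
      have hfin : volume (Ioo a b) ≠ ∞ := by simp
      exact continuous_const.add ((ENNReal.continuous_mul_const hfin).comp h1)
    have := (hcont.tendsto 0).mono_left (nhdsWithin_le_nhds (s := Ioi 0))
    simpa using this
  refine le_antisymm (ge_of_tendsto (lim _) ?_) (ge_of_tendsto (lim _) ?_)
  · filter_upwards [self_mem_nhdsWithin] with ε hε using (main ε hε).1
  · filter_upwards [self_mem_nhdsWithin] with ε hε using (main ε hε).2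

end ArcLength

/-! ### Parametrization and length of a Cassini level set. -/

section LevelSet

open Set Complex

theorem re_cpow_half_pos {u : ℂ} (hu : u ∈ slitPlane) : 0 < (u ^ (1 / 2 : ℂ)).re := by
  have h0 : u ≠ 0 := slitPlane_ne_zero hu
  have h1 : arg u ≠ Real.pi := (mem_slitPlane_iff_arg.1 hu).1
  have h2 : -Real.pi < arg u := neg_pi_lt_arg u
  have h3 : arg u < Real.pi := lt_of_le_of_ne (arg_le_pi u) h1
  have h4 : (log u * (1 / 2 : ℂ)).im = arg u / 2 := by
    rw [show (1 / 2 : ℂ) = ((1 / 2 : ℝ) : ℂ) by norm_num, im_mul_ofReal, log_im]; ring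
  rw [cpow_def_of_ne_zero h0, exp_re, h4]
  exact mul_pos (Real.exp_pos _) (Real.cos_pos_of_mem_Ioo ⟨by linarith, by linarith⟩)

theorem cpow_half_sq (u : ℂ) : (u ^ (1 / 2 : ℂ)) ^ 2 = u := by
  rw [one_div]; exact cpow_nat_inv_pow u two_ne_zero

theorem ofReal_add_mul_exp_mem_slitPlane {a s θ : ℝ} (ha : 0 ≤ a) (hs : 0 < s)
    (hθ : θ ∈ Ioo (-Real.pi) Real.pi) : (a : ℂ) + s * exp (θ * I) ∈ slitPlane := by
  have hre : ((a : ℂ) + s * exp (θ * I)).re = a + s * Real.cos θ := by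
    simp [exp_ofReal_mul_I_re]
  have him : ((a : ℂ) + s * exp (θ * I)).im = s * Real.sin θ := by
    simp [exp_ofReal_mul_I_im]
  rw [mem_slitPlane_iff, hre, him]
  by_cases h : Real.sin θ = 0
  · left
    have : θ = 0 := (Real.sin_eq_zero_iff_of_lt_of_lt hθ.1 hθ.2).1 h
    simp only [this, Real.cos_zero]; linarith
  · right
    exact mul_ne_zero hs.ne' h

/-- A parametrization of one half (`σ = 1` or `σ = -1`) of the curve `‖(z - p) ^ 2 + a‖ = s`. -/
noncomputable def halfOval (p : ℂ) (a s : ℝ) (σ : ℂ) (θ : ℝ) : ℂ :=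
  p + σ * (I * ((a : ℂ) + s * exp (θ * I)) ^ (1 / 2 : ℂ))

variable {p : ℂ} {a s : ℝ} {σ : ℂ}

theorem hasDerivAt_halfOval (ha : 0 ≤ a) (hs : 0 < s) {θ : ℝ}
    (hθ : θ ∈ Ioo (-Real.pi) Real.pi) :
    HasDerivAt (halfOval p a s σ)
      (σ * (I * ((1 / 2 : ℂ) * ((a : ℂ) + s * exp (θ * I)) ^ ((1 / 2 : ℂ) - 1) *
        (s * (exp (θ * I) * I))))) θ := by
  have h1 : HasDerivAt (fun z : ℂ => (a : ℂ) + s * exp (z * I)) (s * (exp (θ * I) * I)) (θ : ℂ) := by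
    have := ((((hasDerivAt_id (θ : ℂ)).mul_const I).cexp).const_mul (s : ℂ)).const_add (a : ℂ)
    simpa using this
  have h2 := (h1.cpow_const (c := 1 / 2) (ofReal_add_mul_exp_mem_slitPlane ha hs hθ)).comp_ofReal
  exact ((h2.const_mul I).const_mul σ).const_add p

theorem continuousOn_deriv_halfOval (ha : 0 ≤ a) (hs : 0 < s) :
    ContinuousOn (fun θ : ℝ => σ * (I * ((1 / 2 : ℂ) *
      ((a : ℂ) + s * exp (θ * I)) ^ ((1 / 2 : ℂ) - 1) * (s * (exp (θ * I) * I)))))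
      (Ioo (-Real.pi) Real.pi) := by
  have h1 : ContinuousOn (fun θ : ℝ => ((a : ℂ) + s * exp (θ * I)) ^ ((1 / 2 : ℂ) - 1))
      (Ioo (-Real.pi) Real.pi) :=
    ContinuousOn.cpow_const (by fun_prop)
      fun θ hθ => ofReal_add_mul_exp_mem_slitPlane ha hs hθ
  have h2 : Continuous fun θ : ℝ => (s : ℂ) * (exp (θ * I) * I) := by fun_prop
  exact continuousOn_const.mul (continuousOn_const.mul
    ((continuousOn_const.mul h1).mul h2.continuousOn))

theorem norm_deriv_halfOval (hσ : ‖σ‖ = 1) (hs : 0 < s) (θ : ℝ) :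
    ‖σ * (I * ((1 / 2 : ℂ) * ((a : ℂ) + s * exp (θ * I)) ^ ((1 / 2 : ℂ) - 1) *
        (s * (exp (θ * I) * I))))‖ = s / 2 * ‖(a : ℂ) + s * exp (θ * I)‖ ^ (-1 / 2 : ℝ) := by
  have : ((1 / 2 : ℂ) - 1) = ((-1 / 2 : ℝ) : ℂ) := by push_cast; norm_num
  rw [this]
  simp only [norm_mul, hσ, norm_I, norm_cpow_real, norm_exp_ofReal_mul_I, norm_real,
    Real.norm_of_nonneg hs.le]
  norm_num
  ring

theorem halfOval_sub_sq (hσ : σ ^ 2 = 1) (θ : ℝ) :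
    (halfOval p a s σ θ - p) ^ 2 = -((a : ℂ) + s * exp (θ * I)) := by
  rw [halfOval, add_sub_cancel_left, mul_pow, mul_pow, hσ, cpow_half_sq, I_sq]; ring

theorem injOn_halfOval (hσ : σ ^ 2 = 1) (hs : 0 < s) :
    InjOn (halfOval p a s σ) (Ioo (-Real.pi) Real.pi) := by
  intro x hx y hy hxy
  have h := halfOval_sub_sq (p := p) (a := a) (s := s) hσ x
  rw [hxy, halfOval_sub_sq hσ y, neg_inj, add_right_inj,
    mul_right_inj' (ofReal_ne_zero.2 hs.ne')] at h
  have := exp_inj_of_neg_pi_lt_of_le_pi (x := y * I) (y := x * I) (by simpa using hy.1)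
    (by simpa using hy.2.le) (by simpa using hx.1) (by simpa using hx.2.le) h
  exact (ofReal_injective (mul_right_cancel₀ I_ne_zero this)).symm

theorem measurableSet_image_halfOval (hσ : σ ^ 2 = 1) (ha : 0 ≤ a) (hs : 0 < s) :
    MeasurableSet (halfOval p a s σ '' Ioo (-Real.pi) Real.pi) :=
  measurableSet_Ioo.image_of_continuousOn_injOn
    (fun _ hx => (hasDerivAt_halfOval ha hs hx).continuousAt.continuousWithinAt)
    (injOn_halfOval hσ hs)

theorem hausdorffMeasure_image_halfOval (hσ : σ ^ 2 = 1) (hσ' : ‖σ‖ = 1) (ha : 0 ≤ a)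
    (hs : 0 < s) :
    Measure.hausdorffMeasure 1 (halfOval p a s σ '' Ioo (-Real.pi) Real.pi) =
      ∫⁻ θ in Ioo (-Real.pi) Real.pi,
        ENNReal.ofReal (s / 2 * ‖(a : ℂ) + s * exp (θ * I)‖ ^ (-1 / 2 : ℝ)) := by
  rw [hausdorffMeasure_image_eq_lintegral_enorm_deriv
    (fun θ hθ => hasDerivAt_halfOval ha hs hθ) (continuousOn_deriv_halfOval ha hs)
    (injOn_halfOval hσ hs)]
  refine lintegral_congr fun θ => ?_
  rw [← ofReal_norm, norm_deriv_halfOval hσ' hs]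

/-- The principal square root has positive real part off the cut, so multiplication by `i` puts one
arc strictly above the horizontal line through `p` and the other strictly below. -/
theorem disjoint_image_halfOval (ha : 0 ≤ a) (hs : 0 < s) :
    Disjoint (halfOval p a s 1 '' Ioo (-Real.pi) Real.pi)
      (halfOval p a s (-1) '' Ioo (-Real.pi) Real.pi) := by
  rw [Set.disjoint_left]
  rintro _ ⟨x, hx, rfl⟩ ⟨y, hy, hxy⟩
  have h1 := re_cpow_half_pos (ofReal_add_mul_exp_mem_slitPlane ha hs hx)
  have h2 := re_cpow_half_pos (ofReal_add_mul_exp_mem_slitPlane ha hs hy)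
  have h3 := congrArg im hxy
  simp only [halfOval, add_im, neg_mul, one_mul, neg_im, I_mul_im] at h3
  linarith

/-- The angle `θ = π` is left out because there `a + s e^{iθ} = a - s` may be zero or on the branch
cut; the points lost form one fibre of the squaring map. -/
theorem level_set_subset :
    {z : ℂ | ‖(z - p) ^ 2 + a‖ = s} ⊆
      (halfOval p a s 1 '' Ioo (-Real.pi) Real.pi ∪
        halfOval p a s (-1) '' Ioo (-Real.pi) Real.pi) ∪ {z : ℂ | (z - p) ^ 2 = s - a} := by
  intro z hz
  set v : ℂ := -((z - p) ^ 2 + a) with hv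
  have hvs : ‖v‖ = s := by rw [hv, norm_neg]; exact hz
  have hvexp : s * exp (arg v * I) = v := by rw [← hvs]; exact norm_mul_exp_arg_mul_I v
  rcases (arg_le_pi v).lt_or_eq with hlt | heq
  · left
    have hmem : arg v ∈ Ioo (-Real.pi) Real.pi := ⟨neg_pi_lt_arg v, hlt⟩
    set q : ℂ := I * ((a : ℂ) + s * exp (arg v * I)) ^ (1 / 2 : ℂ) with hq
    have hsq : (z - p) ^ 2 = q ^ 2 := by
      rw [hq, mul_pow, cpow_half_sq, I_sq, hvexp, hv]; ring
    rcases sq_eq_sq_iff_eq_or_eq_neg.1 hsq with h | h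
    · refine Or.inl ⟨arg v, hmem, ?_⟩
      rw [halfOval, ← hq, one_mul, ← h]; ring
    · refine Or.inr ⟨arg v, hmem, ?_⟩
      rw [halfOval, ← hq, neg_one_mul, ← h]; ring
  · right
    rw [heq, exp_pi_mul_I] at hvexp
    change (z - p) ^ 2 = s - a
    linear_combination hvexp + hv

theorem subset_level_set (hσ : σ ^ 2 = 1) (hs : 0 < s) (A : Set ℝ) :
    halfOval p a s σ '' A ⊆ {z : ℂ | ‖(z - p) ^ 2 + a‖ = s} := by
  rintro _ ⟨θ, -, rfl⟩
  change ‖_‖ = s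
  rw [halfOval_sub_sq hσ, neg_add_rev, neg_add_cancel_right, norm_neg, norm_mul,
    norm_exp_ofReal_mul_I, norm_real, Real.norm_of_nonneg hs.le, mul_one]

theorem hausdorffMeasure_sq_fiber (p b : ℂ) :
    Measure.hausdorffMeasure 1 {z : ℂ | (z - p) ^ 2 = b} = 0 := by
  have := Measure.nullSingletonClass_hausdorff ℂ (d := 1) one_pos
  refine Set.Countable.measure_zero ?_ _
  have hsub : {z : ℂ | (z - p) ^ 2 = b} ⊆ {p + b ^ (1 / 2 : ℂ), p - b ^ (1 / 2 : ℂ)} := by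
    intro z hz
    have h : (z - p) ^ 2 = (b ^ (1 / 2 : ℂ)) ^ 2 := by rw [cpow_half_sq]; exact hz
    rcases sq_eq_sq_iff_eq_or_eq_neg.1 h with h | h
    · left; rw [← h]; ring
    · right; rw [Set.mem_singleton_iff, sub_eq_add_neg, ← h]; ring
  exact (Set.toFinite _).countable.mono hsub

/-- The length of the Cassini oval `‖(z - p) ^ 2 + a‖ = s`. -/
theorem hausdorffMeasure_level_set (p : ℂ) (ha : 0 ≤ a) (hs : 0 < s) :
    Measure.hausdorffMeasure 1 {z : ℂ | ‖(z - p) ^ 2 + a‖ = s} =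
      ∫⁻ θ in Ioo (-Real.pi) Real.pi,
        ENNReal.ofReal (s * ‖(a : ℂ) + s * exp (θ * I)‖ ^ (-1 / 2 : ℝ)) := by
  set A := halfOval p a s 1 '' Ioo (-Real.pi) Real.pi with hA
  set B := halfOval p a s (-1) '' Ioo (-Real.pi) Real.pi with hB
  have h1 : Measure.hausdorffMeasure 1 {z : ℂ | ‖(z - p) ^ 2 + a‖ = s} =
      Measure.hausdorffMeasure 1 (A ∪ B) := by
    refine le_antisymm ?_ (measure_mono (union_subset (subset_level_set (by norm_num) hs _)
      (subset_level_set (by norm_num) hs _)))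
    refine (measure_mono (level_set_subset)).trans ((measure_union_le _ _).trans ?_)
    rw [hausdorffMeasure_sq_fiber, add_zero]
  rw [h1, measure_union (disjoint_image_halfOval ha hs)
    (measurableSet_image_halfOval (by norm_num) ha hs),
    hausdorffMeasure_image_halfOval (by norm_num) (by norm_num) ha hs,
    hausdorffMeasure_image_halfOval (by norm_num) (by norm_num) ha hs,
    ← lintegral_add_left' ]
  · refine lintegral_congr fun θ => ?_
    rw [← ENNReal.ofReal_add (by positivity) (by positivity)]
    congr 1; ring
  · exact Measurable.aemeasurable (by fun_prop)

end LevelSet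

/-! ### Monotonicity of circle means of `|1 + z|^{-1/2}`. -/

section CircleMean

open Set Complex Filter Topology

theorem norm_one_add_mul_exp_ge (z : ℂ) (θ : ℝ) : 1 - ‖z‖ ≤ ‖1 + z * exp (θ * I)‖ := by
  have h := norm_sub_norm_le (1 : ℂ) (-(z * exp (θ * I)))
  rwa [norm_neg, norm_mul, norm_exp_ofReal_mul_I, mul_one, norm_one, sub_neg_eq_add] at h

theorem one_add_mul_exp_mem_slitPlane {z : ℂ} (hz : ‖z‖ < 1) (θ : ℝ) :
    1 + z * exp (θ * I) ∈ slitPlane :=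
  mem_slitPlane_of_norm_lt_one (by rwa [norm_mul, norm_exp_ofReal_mul_I, mul_one])

/-- Pairing the functions `(1 + z e^{iθ})^{-1/2}` with a bounded function of `θ` is holomorphic
in `z` on the unit disc. -/
theorem differentiableOn_integral_cpow_mul {k : ℝ → ℂ} (hk : Measurable k)
    (hk1 : ∀ θ, ‖k θ‖ ≤ 1) :
    DifferentiableOn ℂ (fun z : ℂ => ∫ θ in (-Real.pi)..Real.pi,
      (1 + z * exp (θ * I)) ^ (-1 / 2 : ℂ) * k θ) (Metric.ball 0 1) := by
  intro z₀ hz₀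
  rw [mem_ball_zero_iff] at hz₀
  -- On a disc of radius `ρ < 1` containing `z₀`, `|1 + z e^{iθ}| ≥ 1 - ρ`, which dominates the
  -- differentiated integrand uniformly.
  set ρ : ℝ := (1 + ‖z₀‖) / 2 with hρ
  have hρ1 : ρ < 1 := by rw [hρ]; linarith
  have hzρ : ‖z₀‖ < ρ := by rw [hρ]; linarith
  have hnhds : Metric.ball (0 : ℂ) ρ ∈ 𝓝 z₀ :=
    Metric.isOpen_ball.mem_nhds (by rwa [mem_ball_zero_iff])
  have hmeas : ∀ (c z : ℂ), Measurable fun θ : ℝ => (1 + z * exp (θ * I)) ^ c := fun c z =>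
    Measurable.pow_const (by fun_prop) c
  have hd := intervalIntegral.hasDerivAt_integral_of_dominated_loc_of_deriv_le
    (μ := volume) (a := -Real.pi) (b := Real.pi)
    (F := fun (z : ℂ) (θ : ℝ) => (1 + z * exp (θ * I)) ^ (-1 / 2 : ℂ) * k θ)
    (F' := fun (z : ℂ) (θ : ℝ) =>
      (-1 / 2 : ℂ) * (1 + z * exp (θ * I)) ^ ((-1 / 2 : ℂ) - 1) * exp (θ * I) * k θ)
    (bound := fun _ => 1 / 2 * (1 - ρ) ^ (-3 / 2 : ℝ)) hnhds
    (Eventually.of_forall fun z => ((hmeas _ z).mul hk).aestronglyMeasurable)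
    ?_ (Measurable.aestronglyMeasurable ?_) (Eventually.of_forall ?_) (by simp)
    (Eventually.of_forall ?_)
  · exact hd.2.differentiableAt.differentiableWithinAt
  · refine IntervalIntegrable.mono_fun' (g := fun _ => (1 - ρ) ^ (-1 / 2 : ℝ)) (by simp)
      ((hmeas _ z₀).mul hk).aestronglyMeasurable (Eventually.of_forall fun θ => ?_)
    beta_reduce
    rw [norm_mul, show (-1 / 2 : ℂ) = ((-1 / 2 : ℝ) : ℂ) by push_cast; rfl, norm_cpow_real]
    refine (mul_le_of_le_one_right (by positivity) (hk1 θ)).trans ?_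
    exact Real.rpow_le_rpow_of_nonpos (by linarith)
      (by linarith [norm_one_add_mul_exp_ge z₀ θ]) (by norm_num)
  · exact ((((hmeas _ z₀).const_mul _).mul (by fun_prop)).mul hk)
  · intro θ _ z hz
    rw [mem_ball_zero_iff] at hz
    have he : ((-1 / 2 : ℂ) - 1) = ((-3 / 2 : ℝ) : ℂ) := by push_cast; norm_num
    rw [norm_mul, norm_mul, norm_mul, he, norm_cpow_real, norm_exp_ofReal_mul_I, mul_one]
    refine (mul_le_of_le_one_right (by positivity) (hk1 θ)).trans ?_
    have h1 : ‖(-1 / 2 : ℂ)‖ = 1 / 2 := by norm_num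
    rw [h1]
    refine mul_le_mul_of_nonneg_left ?_ (by norm_num)
    exact Real.rpow_le_rpow_of_nonpos (by linarith)
      (by linarith [norm_one_add_mul_exp_ge z θ]) (by norm_num)
  · intro θ _ z hz
    rw [mem_ball_zero_iff] at hz
    have h1 : HasDerivAt (fun z : ℂ => 1 + z * exp (θ * I)) (exp (θ * I)) z := by
      simpa using ((hasDerivAt_id z).mul_const (exp (θ * I))).const_add 1
    exact (h1.cpow_const (one_add_mul_exp_mem_slitPlane (hz.trans hρ1) θ)).mul_const (k θ)

/-- Writing `z = |z| e^{i arg z}` shifts the angle, which is harmless over a full period. -/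
theorem integral_circle_rotate {g : ℂ → ℝ} {z : ℂ} :
    ∫ θ in (-Real.pi)..Real.pi, g (z * exp (θ * I)) =
      ∫ θ in (-Real.pi)..Real.pi, g (‖z‖ * exp (θ * I)) := by
  set G : ℝ → ℝ := fun θ => g (‖z‖ * exp (θ * I)) with hG
  have hper : Function.Periodic G (2 * Real.pi) := by
    intro θ
    simp only [hG]
    congr 2
    push_cast
    rw [add_mul, exp_add, exp_two_pi_mul_I, mul_one]
  have h1 : ∀ θ : ℝ, g (z * exp (θ * I)) = G (θ + arg z) := by
    intro θ
    simp only [hG]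
    congr 1
    conv_lhs => rw [← norm_mul_exp_arg_mul_I z]
    push_cast
    rw [add_mul, exp_add]; ring
  simp_rw [h1]
  rw [intervalIntegral.integral_comp_add_right]
  have := hper.intervalIntegral_add_eq (-Real.pi + arg z) (-Real.pi)
  convert this using 2 <;> ring

theorem continuous_norm_rpow {t : ℝ} (ht : 0 ≤ t) (ht1 : t < 1) (c : ℝ) :
    Continuous fun θ : ℝ => ‖(1 : ℂ) + t * exp (θ * I)‖ ^ c := by
  refine Continuous.rpow_const (by fun_prop) fun θ => Or.inl ?_
  have := norm_one_add_mul_exp_ge t θ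
  rw [norm_real, Real.norm_of_nonneg ht] at this
  linarith

/-- The circle means of `|1 + z|^{-1/2}` increase with the radius. -/
theorem integral_norm_rpow_mono {t t' : ℝ} (ht : 0 ≤ t) (htt : t ≤ t') (ht' : t' < 1) :
    ∫ θ in (-Real.pi)..Real.pi, ‖(1 : ℂ) + t * exp (θ * I)‖ ^ (-1 / 2 : ℝ) ≤
      ∫ θ in (-Real.pi)..Real.pi, ‖(1 : ℂ) + t' * exp (θ * I)‖ ^ (-1 / 2 : ℝ) := by
  have hpi : -Real.pi ≤ Real.pi := by linarith [Real.pi_pos]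
  rcases (ht.trans htt).eq_or_lt with h0 | h0
  · rw [le_antisymm htt (h0 ▸ ht)]
  set H : ℝ → ℂ := fun θ => (1 + t * exp (θ * I)) ^ (-1 / 2 : ℂ) with hH
  have hc : (-1 / 2 : ℂ) = ((-1 / 2 : ℝ) : ℂ) := by push_cast; rfl
  have hHm : Measurable H := Measurable.pow_const (by fun_prop) _
  -- Duality in place of subharmonicity: `k` is the conjugate phase at radius `t`, frozen in `θ`.
  -- The holomorphic pairing `φ` then equals the mean at `z = t` and is bounded by the larger mean
  -- on `|z| = t'`, so the maximum principle applies.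
  set k : ℝ → ℂ := fun θ => conj (H θ) / ‖H θ‖ with hkdef
  have hk : Measurable k := by
    have := (continuous_conj.measurable.comp hHm).div (measurable_ofReal.comp hHm.norm)
    exact this
  have hk1 : ∀ θ, ‖k θ‖ ≤ 1 := by
    intro θ
    simp only [hkdef, norm_div, RCLike.norm_conj, norm_real, norm_norm]
    exact div_self_le_one _
  have hHk : ∀ θ, H θ * k θ = ‖H θ‖ := by
    intro θ
    simp only [hkdef]
    rw [mul_div_assoc', mul_conj, normSq_eq_norm_sq]
    rcases eq_or_ne ‖H θ‖ 0 with h | h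
    · simp [h]
    · have : (‖H θ‖ : ℂ) ≠ 0 := ofReal_ne_zero.2 h
      push_cast
      field_simp
  set φ : ℂ → ℂ := fun z => ∫ θ in (-Real.pi)..Real.pi,
      (1 + z * exp (θ * I)) ^ (-1 / 2 : ℂ) * k θ with hφ
  have hd := differentiableOn_integral_cpow_mul hk hk1
  have hdc : DiffContOnCl ℂ φ (Metric.ball 0 t') := by
    refine DifferentiableOn.diffContOnCl ?_
    rw [closure_ball _ h0.ne']
    exact hd.mono (Metric.closedBall_subset_ball ht')
  have hbound : ∀ z ∈ frontier (Metric.ball (0 : ℂ) t'), ‖φ z‖ ≤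
      ∫ θ in (-Real.pi)..Real.pi, ‖(1 : ℂ) + t' * exp (θ * I)‖ ^ (-1 / 2 : ℝ) := by
    intro z hz
    rw [frontier_ball _ h0.ne', mem_sphere_zero_iff_norm] at hz
    have hrot := integral_circle_rotate (g := fun u => ‖1 + u‖ ^ (-1 / 2 : ℝ)) (z := z)
    rw [hz] at hrot
    rw [← hrot]
    refine intervalIntegral.norm_integral_le_of_norm_le hpi (Eventually.of_forall fun θ _ => ?_) ?_
    · rw [norm_mul, hc, norm_cpow_real]
      exact mul_le_of_le_one_right (by positivity) (hk1 θ)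
    · refine (Continuous.rpow_const (by fun_prop) fun θ => Or.inl ?_).intervalIntegrable _ _
      have := norm_one_add_mul_exp_ge z θ
      rw [hz] at this
      linarith
  have hmax := Complex.norm_le_of_forall_mem_frontier_norm_le Metric.isBounded_ball hdc hbound
    (z := t) (by
      rw [closure_ball _ h0.ne', mem_closedBall_zero_iff, norm_real, Real.norm_of_nonneg ht]
      exact htt)
  refine le_trans (le_of_eq ?_) hmax
  have hval : φ t = ((∫ θ in (-Real.pi)..Real.pi,
      ‖(1 : ℂ) + t * exp (θ * I)‖ ^ (-1 / 2 : ℝ) : ℝ) : ℂ) := by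
    rw [← intervalIntegral.integral_ofReal]
    refine intervalIntegral.integral_congr fun θ _ => ?_
    have := hHk θ
    simp only [hH] at this ⊢
    rw [this, hc, norm_cpow_real]
  rw [hval, norm_real, Real.norm_of_nonneg]
  exact intervalIntegral.integral_nonneg hpi fun θ _ => by positivity

/-- The circle mean of `|1 + z|^{-1/2}` over a circle inside the unit disc is at most its mean over
the unit circle. -/
theorem integral_norm_rpow_le_unit {t : ℝ} (ht : 0 ≤ t) (ht1 : t < 1)
    (hint : IntervalIntegrable (fun θ : ℝ => ‖(1 : ℂ) + exp (θ * I)‖ ^ (-1 / 2 : ℝ)) volume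
      (-Real.pi) Real.pi) :
    ∫ θ in (-Real.pi)..Real.pi, ‖(1 : ℂ) + t * exp (θ * I)‖ ^ (-1 / 2 : ℝ) ≤
      ∫ θ in (-Real.pi)..Real.pi, ‖(1 : ℂ) + exp (θ * I)‖ ^ (-1 / 2 : ℝ) := by
  have hne : ∀ᵐ θ : ℝ, θ ≠ Real.pi := by
    simp [ae_iff]
  have hpos : ∀ θ : ℝ, θ ≠ Real.pi → θ ∈ uIoc (-Real.pi) Real.pi →
      0 < ‖(1 : ℂ) + exp (θ * I)‖ := by
    intro θ h1 h2
    rw [uIoc_of_le (by linarith [Real.pi_pos])] at h2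
    have := ofReal_add_mul_exp_mem_slitPlane (a := 1) (s := 1) (θ := θ) zero_le_one one_pos
      ⟨h2.1, lt_of_le_of_ne h2.2 h1⟩
    simpa using slitPlane_ne_zero this
  have hlim : Tendsto (fun t' : ℝ => ∫ θ in (-Real.pi)..Real.pi,
      ‖(1 : ℂ) + t' * exp (θ * I)‖ ^ (-1 / 2 : ℝ)) (𝓝[<] 1)
      (𝓝 (∫ θ in (-Real.pi)..Real.pi, ‖(1 : ℂ) + exp (θ * I)‖ ^ (-1 / 2 : ℝ))) := by
    -- The factor `1/2` comes from `|1 + e^{iθ}| ≤ |1 + t' e^{iθ}| + (1 - t') ≤ 2 |1 + t' e^{iθ}|`.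
    refine intervalIntegral.tendsto_integral_filter_of_dominated_convergence
      (fun θ : ℝ => (1 / 2 : ℝ) ^ (-1 / 2 : ℝ) * ‖(1 : ℂ) + exp (θ * I)‖ ^ (-1 / 2 : ℝ)) ?_ ?_
      (hint.const_mul _) ?_
    · exact Eventually.of_forall fun t' => Measurable.aestronglyMeasurable (by fun_prop)
    · filter_upwards [Ioo_mem_nhdsLT (zero_lt_one (α := ℝ))] with t' ht'
      filter_upwards [hne] with θ hθ hθ'
      have hp := hpos θ hθ hθ'
      rw [Real.norm_of_nonneg (by positivity), ← Real.mul_rpow (by norm_num) hp.le]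
      refine Real.rpow_le_rpow_of_nonpos (by positivity) ?_ (by norm_num)
      have h1 := norm_one_add_mul_exp_ge t' θ
      rw [norm_real, Real.norm_of_nonneg ht'.1.le] at h1
      have h2 : ‖(1 : ℂ) + exp (θ * I)‖ ≤ ‖(1 : ℂ) + t' * exp (θ * I)‖ + (1 - t') := by
        have : (1 : ℂ) + exp (θ * I) =
            (1 + t' * exp (θ * I)) + ((1 - t' : ℝ) : ℂ) * exp (θ * I) := by
          push_cast; ring
        rw [this]
        refine (norm_add_le _ _).trans ?_
        rw [norm_mul ((1 - t' : ℝ) : ℂ), norm_exp_ofReal_mul_I, norm_real,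
          Real.norm_of_nonneg (by linarith [ht'.2]), mul_one]
      linarith
    · filter_upwards [hne] with θ hθ hθ'
      have hp := hpos θ hθ hθ'
      have hcont : ContinuousAt
          (fun t' : ℝ => ‖(1 : ℂ) + t' * exp (θ * I)‖ ^ (-1 / 2 : ℝ)) 1 := by
        refine ContinuousAt.rpow_const (by fun_prop) (Or.inl ?_)
        simpa using hp.ne'
      have := hcont.tendsto.mono_left (nhdsWithin_le_nhds (s := Iio 1))
      simpa using this
  refine ge_of_tendsto hlim ?_
  filter_upwards [Ioo_mem_nhdsLT ht1] with t' ht'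
  exact integral_norm_rpow_mono ht ht'.1.le ht'.2

end CircleMean

/-! ### The extremal integral through Beta and Gamma, and its numerical bound. -/

section Gamma

open Set Filter Topology

theorem norm_one_add_exp_sq (θ : ℝ) :
    ‖(1 : ℂ) + Complex.exp (θ * Complex.I)‖ ^ 2 = 4 * (1 - (1 - Real.cos θ) / 2) := by
  rw [Complex.sq_norm, Complex.normSq_apply]
  simp only [Complex.add_re, Complex.one_re, Complex.exp_ofReal_mul_I_re, Complex.add_im,
    Complex.one_im, Complex.exp_ofReal_mul_I_im]
  linear_combination Real.sin_sq_add_cos_sq θ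

theorem image_one_sub_cos_div_two :
    (fun θ : ℝ => (1 - Real.cos θ) / 2) '' Ioo 0 Real.pi = Ioo 0 1 := by
  ext x
  constructor
  · rintro ⟨θ, hθ, rfl⟩
    have h1 := Real.cos_lt_cos_of_nonneg_of_le_pi le_rfl hθ.2.le hθ.1
    have h2 := Real.cos_lt_cos_of_nonneg_of_le_pi hθ.1.le le_rfl hθ.2
    rw [Real.cos_zero] at h1
    rw [Real.cos_pi] at h2
    exact ⟨by beta_reduce; linarith, by beta_reduce; linarith⟩
  · intro hx
    have h : Real.cos (Real.arccos (1 - 2 * x)) = 1 - 2 * x :=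
      Real.cos_arccos (by linarith [hx.2]) (by linarith [hx.1])
    refine ⟨Real.arccos (1 - 2 * x), ⟨Real.arccos_pos.2 (by linarith [hx.1]), ?_⟩, ?_⟩
    · refine lt_of_le_of_ne (Real.arccos_le_pi _) fun h' => ?_
      rw [h', Real.cos_pi] at h
      linarith [hx.2]
    · beta_reduce
      rw [h]; ring

/-- Substituting `x = sin²(θ/2)` gives `dx = √(x(1-x)) dθ` and `|1 + e^{iθ}| = 2 √(1-x)`. -/
theorem abs_deriv_smul_beta_integrand {θ : ℝ} (hθ : θ ∈ Ioo 0 Real.pi) :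
    |Real.sin θ / 2| • (((1 - Real.cos θ) / 2) ^ (-1 / 2 : ℝ) *
        (1 - (1 - Real.cos θ) / 2) ^ (-3 / 4 : ℝ)) =
      √2 * ‖(1 : ℂ) + Complex.exp (θ * Complex.I)‖ ^ (-1 / 2 : ℝ) := by
  set x := (1 - Real.cos θ) / 2 with hx
  have hmem : x ∈ Ioo (0 : ℝ) 1 := image_one_sub_cos_div_two ▸ mem_image_of_mem _ hθ
  have hx0 : 0 < x := hmem.1
  have hx1 : 0 < 1 - x := by linarith [hmem.2]
  have hsin : |Real.sin θ / 2| = x ^ (1 / 2 : ℝ) * (1 - x) ^ (1 / 2 : ℝ) := by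
    rw [← Real.mul_rpow hx0.le hx1.le, ← Real.sqrt_eq_rpow, ← Real.sqrt_sq_eq_abs]
    congr 1
    have := Real.sin_sq_add_cos_sq θ
    rw [hx]; linear_combination this / 4
  have hn : ‖(1 : ℂ) + Complex.exp (θ * Complex.I)‖ = 2 * (1 - x) ^ (1 / 2 : ℝ) := by
    rw [← Real.sqrt_eq_rpow, ← Real.sqrt_sq (norm_nonneg _), norm_one_add_exp_sq,
      Real.sqrt_mul (by norm_num), show √(4 : ℝ) = 2 by
        rw [show (4 : ℝ) = 2 ^ 2 by norm_num, Real.sqrt_sq zero_le_two]]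
  rw [hsin, hn, Real.mul_rpow zero_le_two (by positivity), ← Real.rpow_mul hx1.le,
    Real.sqrt_eq_rpow, smul_eq_mul, ← mul_assoc (2 ^ (1 / 2 : ℝ) : ℝ),
    ← Real.rpow_add two_pos]
  have e1 : x ^ (1 / 2 : ℝ) * x ^ (-1 / 2 : ℝ) = 1 := by
    rw [← Real.rpow_add hx0]; norm_num
  have e2 : (1 - x) ^ (1 / 2 : ℝ) * (1 - x) ^ (-3 / 4 : ℝ) = (1 - x) ^ (-1 / 4 : ℝ) := by
    rw [← Real.rpow_add hx1]; norm_num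
  calc _ = (x ^ (1 / 2 : ℝ) * x ^ (-1 / 2 : ℝ)) *
        ((1 - x) ^ (1 / 2 : ℝ) * (1 - x) ^ (-3 / 4 : ℝ)) := by ring
    _ = _ := by rw [e1, e2]; norm_num

theorem cpow_mul_cpow_eq_ofReal {x : ℝ} (hx : x ∈ Ioo (0 : ℝ) 1) :
    (x : ℂ) ^ (((1 / 2 : ℝ) : ℂ) - 1) * (1 - (x : ℂ)) ^ (((1 / 4 : ℝ) : ℂ) - 1) =
      ((x ^ (-1 / 2 : ℝ) * (1 - x) ^ (-3 / 4 : ℝ) : ℝ) : ℂ) := by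
  rw [Complex.ofReal_mul, Complex.ofReal_cpow hx.1.le, Complex.ofReal_cpow (by linarith [hx.2])]
  push_cast
  norm_num

theorem integrableOn_beta_integrand :
    IntegrableOn (fun x : ℝ => x ^ (-1 / 2 : ℝ) * (1 - x) ^ (-3 / 4 : ℝ)) (Ioo 0 1) := by
  have h := Complex.betaIntegral_convergent (u := ((1 / 2 : ℝ) : ℂ)) (v := ((1 / 4 : ℝ) : ℂ))
    (by rw [Complex.ofReal_re]; norm_num) (by rw [Complex.ofReal_re]; norm_num)
  rw [intervalIntegrable_iff_integrableOn_Ioo_of_le zero_le_one] at h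
  have h2 := Integrable.re h
  refine IntegrableOn.congr_fun h2 (fun x hx => ?_) measurableSet_Ioo
  rw [cpow_mul_cpow_eq_ofReal hx]
  exact Complex.ofReal_re _

theorem integral_beta_integrand :
    ∫ x in Ioo (0 : ℝ) 1, x ^ (-1 / 2 : ℝ) * (1 - x) ^ (-3 / 4 : ℝ) =
      Real.Gamma (1 / 2) * Real.Gamma (1 / 4) / Real.Gamma (3 / 4) := by
  have h := ProbabilityTheory.beta_eq_betaIntegralReal (1 / 2) (1 / 4) (by norm_num) (by norm_num)
  have h3 : Complex.betaIntegral ((1 / 2 : ℝ) : ℂ) ((1 / 4 : ℝ) : ℂ) =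
      ((∫ x in Ioo (0 : ℝ) 1, x ^ (-1 / 2 : ℝ) * (1 - x) ^ (-3 / 4 : ℝ) : ℝ) : ℂ) := by
    rw [Complex.betaIntegral, intervalIntegral.integral_of_le zero_le_one,
      integral_Ioc_eq_integral_Ioo, ← integral_complex_ofReal]
    exact setIntegral_congr_fun measurableSet_Ioo fun x hx => cpow_mul_cpow_eq_ofReal hx
  rw [h3, Complex.ofReal_re, ProbabilityTheory.beta] at h
  rw [← h]
  norm_num

theorem hasDerivAt_one_sub_cos_div_two (θ : ℝ) :
    HasDerivAt (fun θ : ℝ => (1 - Real.cos θ) / 2) (Real.sin θ / 2) θ := by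
  simpa using ((Real.hasDerivAt_cos θ).const_sub 1).div_const 2

theorem injOn_one_sub_cos_div_two :
    InjOn (fun θ : ℝ => (1 - Real.cos θ) / 2) (Ioo 0 Real.pi) := by
  intro x hx y hy h
  refine Real.injOn_cos ⟨hx.1.le, hx.2.le⟩ ⟨hy.1.le, hy.2.le⟩ ?_
  simp only at h
  linarith

theorem integrableOn_norm_one_add_exp_rpow :
    IntegrableOn (fun θ : ℝ => ‖(1 : ℂ) + Complex.exp (θ * Complex.I)‖ ^ (-1 / 2 : ℝ))
      (Ioo 0 Real.pi) := by
  have h := (integrableOn_image_iff_integrableOn_abs_deriv_smul measurableSet_Ioo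
    (fun θ _ => (hasDerivAt_one_sub_cos_div_two θ).hasDerivWithinAt) injOn_one_sub_cos_div_two
    (fun x : ℝ => x ^ (-1 / 2 : ℝ) * (1 - x) ^ (-3 / 4 : ℝ))).1
    (image_one_sub_cos_div_two ▸ integrableOn_beta_integrand)
  have h2 := (h.congr_fun (fun θ hθ => abs_deriv_smul_beta_integrand hθ) measurableSet_Ioo)
  refine IntegrableOn.congr_fun (h2.const_mul (√2)⁻¹) (fun θ _ => ?_) measurableSet_Ioo
  rw [inv_mul_cancel_left₀ (by positivity)]

theorem integral_half_norm_one_add_exp_rpow :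
    √2 * ∫ θ in Ioo 0 Real.pi, ‖(1 : ℂ) + Complex.exp (θ * Complex.I)‖ ^ (-1 / 2 : ℝ) =
      Real.Gamma (1 / 2) * Real.Gamma (1 / 4) / Real.Gamma (3 / 4) := by
  rw [← integral_beta_integrand, ← integral_const_mul, ← image_one_sub_cos_div_two,
    integral_image_eq_integral_abs_deriv_smul measurableSet_Ioo
    (fun θ _ => (hasDerivAt_one_sub_cos_div_two θ).hasDerivWithinAt) injOn_one_sub_cos_div_two]
  exact setIntegral_congr_fun measurableSet_Ioo fun θ hθ => (abs_deriv_smul_beta_integrand hθ).symm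

theorem norm_one_add_exp_neg (θ : ℝ) :
    ‖(1 : ℂ) + Complex.exp ((-θ : ℝ) * Complex.I)‖ = ‖(1 : ℂ) + Complex.exp (θ * Complex.I)‖ := by
  rw [← sq_eq_sq₀ (norm_nonneg _) (norm_nonneg _), norm_one_add_exp_sq, norm_one_add_exp_sq,
    Real.cos_neg]

theorem intervalIntegrable_zero_pi :
    IntervalIntegrable (fun θ : ℝ => ‖(1 : ℂ) + Complex.exp (θ * Complex.I)‖ ^ (-1 / 2 : ℝ))
      volume 0 Real.pi :=
  (intervalIntegrable_iff_integrableOn_Ioo_of_le Real.pi_pos.le).2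
    integrableOn_norm_one_add_exp_rpow

theorem intervalIntegrable_neg_pi_zero :
    IntervalIntegrable (fun θ : ℝ => ‖(1 : ℂ) + Complex.exp (θ * Complex.I)‖ ^ (-1 / 2 : ℝ))
      volume (-Real.pi) 0 := by
  rw [IntervalIntegrable.iff_comp_neg]
  simp only [norm_one_add_exp_neg, neg_neg, neg_zero]
  exact intervalIntegrable_zero_pi.symm

theorem intervalIntegrable_norm_one_add_exp_rpow :
    IntervalIntegrable (fun θ : ℝ => ‖(1 : ℂ) + Complex.exp (θ * Complex.I)‖ ^ (-1 / 2 : ℝ))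
      volume (-Real.pi) Real.pi :=
  intervalIntegrable_neg_pi_zero.trans intervalIntegrable_zero_pi

theorem Gamma_one_quarter_mul_Gamma_three_quarters :
    Real.Gamma (1 / 4) * Real.Gamma (3 / 4) = Real.pi * √2 := by
  have h := Real.Gamma_mul_Gamma_one_sub (1 / 4)
  rw [show (1 : ℝ) - 1 / 4 = 3 / 4 by norm_num, show Real.pi * (1 / 4) = Real.pi / 4 by ring,
    Real.sin_pi_div_four] at h
  rw [h]
  have : √2 * √2 = (2 : ℝ) := Real.mul_self_sqrt zero_le_two
  field_simp
  linear_combination -this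

theorem integral_norm_one_add_exp_rpow :
    ∫ θ in (-Real.pi)..Real.pi, ‖(1 : ℂ) + Complex.exp (θ * Complex.I)‖ ^ (-1 / 2 : ℝ) =
      Real.pi * (Real.Gamma (1 / 4) ^ 2 / Real.pi ^ (3 / 2 : ℝ)) := by
  have hsymm := intervalIntegral.integral_comp_neg (a := 0) (b := Real.pi)
    (fun θ : ℝ => ‖(1 : ℂ) + Complex.exp (θ * Complex.I)‖ ^ (-1 / 2 : ℝ))
  simp only [norm_one_add_exp_neg, neg_zero] at hsymm
  rw [← intervalIntegral.integral_add_adjacent_intervals intervalIntegrable_neg_pi_zero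
    intervalIntegrable_zero_pi, ← hsymm, intervalIntegral.integral_of_le Real.pi_pos.le,
    integral_Ioc_eq_integral_Ioo]
  have h := integral_half_norm_one_add_exp_rpow
  set J := ∫ θ in Ioo 0 Real.pi, ‖(1 : ℂ) + Complex.exp (θ * Complex.I)‖ ^ (-1 / 2 : ℝ)
  have hG := Gamma_one_quarter_mul_Gamma_three_quarters
  have hG3 : 0 < Real.Gamma (3 / 4) := Real.Gamma_pos_of_pos (by norm_num)
  have hp : Real.pi ^ (3 / 2 : ℝ) = Real.pi * √Real.pi := by
    rw [show (3 / 2 : ℝ) = 1 + 1 / 2 by norm_num, Real.rpow_add Real.pi_pos, Real.rpow_one,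
      Real.sqrt_eq_rpow]
  rw [Real.Gamma_one_half_eq] at h
  have h2 : √2 * √2 = (2 : ℝ) := Real.mul_self_sqrt zero_le_two
  have hpp : √Real.pi * √Real.pi = Real.pi := Real.mul_self_sqrt Real.pi_pos.le
  have hsp : 0 < √Real.pi := Real.sqrt_pos.2 Real.pi_pos
  have hs2 : 0 < √(2 : ℝ) := by positivity
  have hpi := Real.pi_pos
  have hJ : √2 * J * Real.Gamma (3 / 4) = √Real.pi * Real.Gamma (1 / 4) := by
    rw [h]; field_simp
  have hJ2 : 2 * J * √Real.pi = Real.Gamma (1 / 4) ^ 2 := by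
    refine mul_right_cancel₀ (mul_pos hG3 hs2).ne' ?_
    calc 2 * J * √Real.pi * (Real.Gamma (3 / 4) * √2)
        = 2 * √Real.pi * (√2 * J * Real.Gamma (3 / 4)) := by ring
      _ = 2 * (√Real.pi * √Real.pi) * Real.Gamma (1 / 4) := by rw [hJ]; ring
      _ = (√2 * √2) * Real.pi * Real.Gamma (1 / 4) := by rw [hpp, h2]
      _ = Real.Gamma (1 / 4) * (Real.Gamma (1 / 4) * Real.Gamma (3 / 4)) * √2 := by rw [hG]; ring
      _ = _ := by ring
  rw [hp, ← hJ2]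
  field_simp
  ring

/-- The quotient `Γ(n + 1/4) / Γ(n + 3/4)`. -/
noncomputable def gammaQuot (n : ℕ) : ℝ := Real.Gamma (n + 1 / 4) / Real.Gamma (n + 3 / 4)

theorem gammaQuot_pos (n : ℕ) : 0 < gammaQuot n :=
  div_pos (Real.Gamma_pos_of_pos (by positivity)) (Real.Gamma_pos_of_pos (by positivity))

theorem gammaQuot_succ (n : ℕ) :
    gammaQuot n = (4 * n + 3) / (4 * n + 1) * gammaQuot (n + 1) := by
  have h1 := Real.Gamma_add_one (s := (n : ℝ) + 1 / 4) (by positivity)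
  have h2 := Real.Gamma_add_one (s := (n : ℝ) + 3 / 4) (by positivity)
  have h3 : 0 < Real.Gamma ((n : ℝ) + 3 / 4) := Real.Gamma_pos_of_pos (by positivity)
  rw [gammaQuot, gammaQuot]
  push_cast
  rw [show (n : ℝ) + 1 + 1 / 4 = n + 1 / 4 + 1 by ring,
    show (n : ℝ) + 1 + 3 / 4 = n + 3 / 4 + 1 by ring, h1, h2]
  have : (n : ℝ) + 3 / 4 ≠ 0 := by positivity
  field_simp

/-- By the recursion this is `n (4n+3)² ≤ (n+1) (4n+1)²`, whose sides differ by exactly 1. -/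
theorem gammaQuot_sq_mul_le_succ (n : ℕ) :
    gammaQuot n ^ 2 * n ≤ gammaQuot (n + 1) ^ 2 * ((n + 1 : ℕ) : ℝ) := by
  rw [gammaQuot_succ n, mul_pow, mul_right_comm, mul_comm (gammaQuot (n + 1) ^ 2)]
  refine mul_le_mul_of_nonneg_right ?_ (sq_nonneg _)
  rw [div_pow, div_mul_eq_mul_div, div_le_iff₀ (by positivity)]
  push_cast
  nlinarith

/-- Log-convexity of Gamma at `n + 1/4`, the midpoint of `n - 1/4` and `n + 3/4`. -/
theorem gammaQuot_sq_mul_le_of_pos {n : ℕ} (hn : 0 < n) :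
    gammaQuot n ^ 2 * (n - 1 / 4) ≤ 1 := by
  have hn1 : (1 : ℝ) ≤ n := by exact_mod_cast hn
  have hpos : (0 : ℝ) < n - 1 / 4 := by linarith
  have h := Real.Gamma_mul_add_mul_le_rpow_Gamma_mul_rpow_Gamma (s := (n : ℝ) - 1 / 4)
    (t := n + 3 / 4) (a := 1 / 2) (b := 1 / 2) hpos (by positivity) (by norm_num) (by norm_num)
    (by norm_num)
  have h2 := Real.Gamma_add_one (s := (n : ℝ) - 1 / 4) hpos.ne'
  rw [show (1 / 2 : ℝ) * (n - 1 / 4) + 1 / 2 * (n + 3 / 4) = n + 1 / 4 by ring] at h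
  rw [show (n : ℝ) - 1 / 4 + 1 = n + 3 / 4 by ring] at h2
  have h0 : 0 < Real.Gamma ((n : ℝ) - 1 / 4) := Real.Gamma_pos_of_pos hpos
  have h1 : 0 < Real.Gamma ((n : ℝ) + 3 / 4) := Real.Gamma_pos_of_pos (by positivity)
  have h3 : 0 < Real.Gamma ((n : ℝ) + 1 / 4) := Real.Gamma_pos_of_pos (by positivity)
  rw [← Real.sqrt_eq_rpow, ← Real.sqrt_eq_rpow, ← Real.sqrt_mul h0.le,
    Real.le_sqrt h3.le (by positivity)] at h
  rw [gammaQuot, div_pow, div_mul_eq_mul_div, div_le_one (by positivity)]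
  calc _ ≤ Real.Gamma (n - 1 / 4) * Real.Gamma (n + 3 / 4) * (n - 1 / 4) := by gcongr
    _ = ((n - 1 / 4) * Real.Gamma (n - 1 / 4)) * Real.Gamma (n + 3 / 4) := by ring
    _ = _ := by rw [← h2]; ring

/-- A nondecreasing sequence bounded by `m / (m - 1/4) → 1` never exceeds 1. This removes the loss
of `1/4`, which at `n = 20` would be too costly for the final bound. -/
theorem gammaQuot_sq_mul_le_one (n : ℕ) : gammaQuot n ^ 2 * n ≤ 1 := by
  have hmono : Monotone fun n : ℕ => gammaQuot n ^ 2 * (n : ℝ) :=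
    monotone_nat_of_le_succ gammaQuot_sq_mul_le_succ
  have hlim : Tendsto (fun m : ℕ => (m : ℝ) / (m + (-1 / 4 : ℝ))) atTop (𝓝 1) :=
    tendsto_natCast_div_add_atTop _
  refine ge_of_tendsto hlim ?_
  filter_upwards [eventually_ge_atTop (max n 1)] with m hm
  refine (hmono (le_of_max_le_left hm)).trans ?_
  have hm1 : 1 ≤ m := le_of_max_le_right hm
  have hm1' : (1 : ℝ) ≤ m := by exact_mod_cast hm1
  have h := gammaQuot_sq_mul_le_of_pos hm1
  beta_reduce
  rw [le_div_iff₀ (by linarith)]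
  nlinarith

theorem lemniscate_constant_bound :
    (1 + √2) / 2 * (Real.Gamma (1 / 4) ^ 2 / Real.pi ^ (3 / 2 : ℝ)) < 2.85 := by
  have hG := Gamma_one_quarter_mul_Gamma_three_quarters
  have hG3 : 0 < Real.Gamma (3 / 4) := Real.Gamma_pos_of_pos (by norm_num)
  have hp : Real.pi ^ (3 / 2 : ℝ) = Real.pi * √Real.pi := by
    rw [show (3 / 2 : ℝ) = 1 + 1 / 2 by norm_num, Real.rpow_add Real.pi_pos, Real.rpow_one,
      Real.sqrt_eq_rpow]
  have hpi := Real.pi_pos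
  have hsp : 0 < √Real.pi := Real.sqrt_pos.2 Real.pi_pos
  have hq : Real.Gamma (1 / 4) ^ 2 = Real.pi * √2 * gammaQuot 0 := by
    rw [gammaQuot, ← hG]
    norm_num
    field_simp
  have h20 := gammaQuot_sq_mul_le_one 20
  -- Twenty steps of the recursion, with factors `(4n+3)/(4n+1)` for `n = 0, …, 19`.
  have hq0 : gammaQuot 0 = (3 * 7 * 11 * 15 * 19 * 23 * 27 * 31 * 35 * 39 * 43 * 47 * 51 * 55 * 59 *
      63 * 67 * 71 * 75 * 79) / (1 * 5 * 9 * 13 * 17 * 21 * 25 * 29 * 33 * 37 * 41 * 45 * 49 * 53 *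
      57 * 61 * 65 * 69 * 73 * 77) * gammaQuot 20 := by
    iterate 20 rw [gammaQuot_succ]
    norm_num
    ring
  have hs2 : √2 < 1.414214 := by
    rw [Real.sqrt_lt' (by norm_num)]; norm_num
  have hq0b : gammaQuot 0 ^ 2 < 2.9588 ^ 2 := by
    rw [hq0, mul_pow]
    have h20' : gammaQuot 20 ^ 2 ≤ 1 / 20 := by
      rw [le_div_iff₀ (by norm_num)]
      exact_mod_cast h20
    refine (mul_le_mul_of_nonneg_left h20' (sq_nonneg _)).trans_lt ?_
    norm_num
  have hq0c : gammaQuot 0 < 2.9588 := lt_of_pow_lt_pow_left₀ 2 (by norm_num) hq0b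
  have hsb : 1.77245 < √Real.pi := by
    rw [Real.lt_sqrt (by norm_num)]
    have := Real.pi_gt_d6
    norm_num at this ⊢
    linarith
  have hval : (1 + √2) / 2 * (Real.Gamma (1 / 4) ^ 2 / Real.pi ^ (3 / 2 : ℝ)) =
      (√2 + 2) / 2 * gammaQuot 0 / √Real.pi := by
    have h2 : √2 * √2 = (2 : ℝ) := Real.mul_self_sqrt zero_le_two
    rw [hq, hp]
    field_simp
    linear_combination gammaQuot 0 * h2
  rw [hval, div_lt_iff₀ hsp]
  have := gammaQuot_pos 0
  nlinarith

end Gamma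

/-! ### The ratio, its extremal case, and the frontier of the lemniscate ball. -/

section CassiniRatio

open Set Filter Topology

/-- Multiplying by `e^{-iθ}` and conjugating preserves the modulus and swaps `a` and `s`. -/
theorem norm_add_mul_exp_comm (a s θ : ℝ) :
    ‖(a : ℂ) + s * Complex.exp (θ * Complex.I)‖ =
      ‖(s : ℂ) + a * Complex.exp (θ * Complex.I)‖ := by
  rw [← sq_eq_sq₀ (norm_nonneg _) (norm_nonneg _), Complex.sq_norm, Complex.sq_norm,
    Complex.normSq_apply, Complex.normSq_apply]
  simp only [Complex.add_re, Complex.ofReal_re, Complex.re_ofReal_mul, Complex.exp_ofReal_mul_I_re,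
    Complex.add_im, Complex.ofReal_im, Complex.im_ofReal_mul, Complex.exp_ofReal_mul_I_im]
  linear_combination (s ^ 2 - a ^ 2) * Real.sin_sq_add_cos_sq θ

theorem norm_add_mul_exp_eq_mul {a s : ℝ} (ha : 0 < a) (θ : ℝ) :
    ‖(a : ℂ) + s * Complex.exp (θ * Complex.I)‖ =
      a * ‖(1 : ℂ) + (s / a : ℝ) * Complex.exp (θ * Complex.I)‖ := by
  have ha' : (a : ℂ) ≠ 0 := Complex.ofReal_ne_zero.2 ha.ne'
  have h : (a : ℂ) + s * Complex.exp (θ * Complex.I) =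
      a * (1 + (s / a : ℝ) * Complex.exp (θ * Complex.I)) := by
    push_cast
    field_simp
  rw [h, norm_mul, Complex.norm_real, Real.norm_of_nonneg ha.le]

theorem exists_norm_add_mul_exp_eq {a s : ℝ} (ha : 0 ≤ a) (hs : 0 < s) :
    ∃ m t : ℝ, 0 < m ∧ a ≤ m ∧ s ≤ m ∧ 0 ≤ t ∧ t ≤ 1 ∧ ∀ θ : ℝ,
      ‖(a : ℂ) + s * Complex.exp (θ * Complex.I)‖ =
        m * ‖(1 : ℂ) + t * Complex.exp (θ * Complex.I)‖ := by
  rcases le_total a s with h | h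
  · exact ⟨s, a / s, hs, h, le_rfl, by positivity, (div_le_one hs).2 h, fun θ => by
      rw [norm_add_mul_exp_comm, norm_add_mul_exp_eq_mul hs]⟩
  · have ha' := hs.trans_le h
    exact ⟨a, s / a, ha', le_rfl, h, by positivity, (div_le_one ha').2 h, fun θ =>
      norm_add_mul_exp_eq_mul ha' θ⟩

theorem intervalIntegrable_norm_one_add_mul_exp {t : ℝ} (ht : 0 ≤ t) (ht1 : t ≤ 1) :
    IntervalIntegrable (fun θ : ℝ => ‖(1 : ℂ) + t * Complex.exp (θ * Complex.I)‖ ^ (-1 / 2 : ℝ))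
      volume (-Real.pi) Real.pi := by
  rcases ht1.lt_or_eq with h | rfl
  · exact (continuous_norm_rpow ht h _).intervalIntegrable _ _
  · simpa using intervalIntegrable_norm_one_add_exp_rpow

theorem integral_norm_one_add_mul_exp_le {t : ℝ} (ht : 0 ≤ t) (ht1 : t ≤ 1) :
    ∫ θ in (-Real.pi)..Real.pi, ‖(1 : ℂ) + t * Complex.exp (θ * Complex.I)‖ ^ (-1 / 2 : ℝ) ≤
      ∫ θ in (-Real.pi)..Real.pi, ‖(1 : ℂ) + Complex.exp (θ * Complex.I)‖ ^ (-1 / 2 : ℝ) := by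
  rcases ht1.lt_or_eq with h | rfl
  · exact integral_norm_rpow_le_unit ht h intervalIntegrable_norm_one_add_exp_rpow
  · simp

/-- `cassiniArcIntegral a s` is the length of `‖z ^ 2 + a‖ = s` divided by `s`. -/
noncomputable def cassiniArcIntegral (a s : ℝ) : ℝ :=
  ∫ θ in (-Real.pi)..Real.pi, ‖(a : ℂ) + s * Complex.exp (θ * Complex.I)‖ ^ (-1 / 2 : ℝ)

theorem intervalIntegrable_cassini {a s : ℝ} (ha : 0 ≤ a) (hs : 0 < s) :
    IntervalIntegrable (fun θ : ℝ => ‖(a : ℂ) + s * Complex.exp (θ * Complex.I)‖ ^ (-1 / 2 : ℝ))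
      volume (-Real.pi) Real.pi := by
  obtain ⟨m, t, hm, -, -, ht, ht1, h⟩ := exists_norm_add_mul_exp_eq ha hs
  simp_rw [h, Real.mul_rpow hm.le (norm_nonneg _)]
  exact (intervalIntegrable_norm_one_add_mul_exp ht ht1).const_mul _

theorem rpow_neg_half_mul_sqrt {m : ℝ} (hm : 0 < m) : m ^ (-1 / 2 : ℝ) * √m = 1 := by
  rw [Real.sqrt_eq_rpow, ← Real.rpow_add hm]; norm_num

/-- The ratio `(1 + √2) / 2 * Γ(1/4)² / π^{3/2}` attained by the Bernoulli lemniscate. -/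
noncomputable def lemniscateRatio : ℝ :=
  (1 + √2) / 2 * (Real.Gamma (1 / 4) ^ 2 / Real.pi ^ (3 / 2 : ℝ))

theorem lemniscateRatio_eq :
    lemniscateRatio = (1 + √2) *
      (∫ θ in (-Real.pi)..Real.pi, ‖(1 : ℂ) + Complex.exp (θ * Complex.I)‖ ^ (-1 / 2 : ℝ)) /
        (2 * Real.pi) := by
  rw [integral_norm_one_add_exp_rpow, lemniscateRatio]
  have := Real.pi_pos
  field_simp

theorem cassiniArcIntegral_mul_le {a s : ℝ} (ha : 0 ≤ a) (hs : 0 < s) :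
    (√(s + a) + √a) * cassiniArcIntegral a s / (2 * Real.pi) ≤ lemniscateRatio := by
  obtain ⟨m, t, hm, ham, hsm, ht, ht1, h⟩ := exists_norm_add_mul_exp_eq ha hs
  rw [cassiniArcIntegral, lemniscateRatio_eq]
  simp_rw [h, Real.mul_rpow hm.le (norm_nonneg _)]
  rw [intervalIntegral.integral_const_mul]
  have hle := integral_norm_one_add_mul_exp_le ht ht1
  have h0 : 0 ≤ ∫ θ in (-Real.pi)..Real.pi,
      ‖(1 : ℂ) + t * Complex.exp (θ * Complex.I)‖ ^ (-1 / 2 : ℝ) :=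
    intervalIntegral.integral_nonneg (by linarith [Real.pi_pos]) fun θ _ => by positivity
  have h1 : √(s + a) + √a ≤ (1 + √2) * √m := by
    have e1 : √(s + a) ≤ √(2 * m) := Real.sqrt_le_sqrt (by linarith)
    have e2 : √a ≤ √m := Real.sqrt_le_sqrt ham
    rw [Real.sqrt_mul zero_le_two] at e1
    linarith
  have hpi := Real.pi_pos
  refine div_le_div_of_nonneg_right ?_ (by positivity)
  calc _ ≤ (1 + √2) * √m * (m ^ (-1 / 2 : ℝ) * ∫ θ in (-Real.pi)..Real.pi,
        ‖(1 : ℂ) + t * Complex.exp (θ * Complex.I)‖ ^ (-1 / 2 : ℝ)) := by gcongr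
    _ = (m ^ (-1 / 2 : ℝ) * √m) * ((1 + √2) * ∫ θ in (-Real.pi)..Real.pi,
        ‖(1 : ℂ) + t * Complex.exp (θ * Complex.I)‖ ^ (-1 / 2 : ℝ)) := by ring
    _ ≤ _ := by
        rw [rpow_neg_half_mul_sqrt hm, one_mul]
        gcongr

theorem cassiniArcIntegral_self_mul {a : ℝ} (ha : 0 < a) :
    (√(a + a) + √a) * cassiniArcIntegral a a / (2 * Real.pi) = lemniscateRatio := by
  rw [cassiniArcIntegral, lemniscateRatio_eq]
  simp_rw [norm_add_mul_exp_eq_mul ha, Real.mul_rpow ha.le (norm_nonneg _)]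
  rw [intervalIntegral.integral_const_mul, div_self ha.ne', ← two_mul, Real.sqrt_mul zero_le_two]
  simp_rw [Complex.ofReal_one, one_mul]
  congr 1
  linear_combination ((1 + √2) * ∫ θ in (-Real.pi)..Real.pi,
        ‖(1 : ℂ) + Complex.exp (θ * Complex.I)‖ ^ (-1 / 2 : ℝ)) * rpow_neg_half_mul_sqrt ha

theorem cassiniDelta_eq (w z : ℂ) :
    cassiniDelta w z = (z - w.re) ^ 2 + ((|w.im| ^ 2 : ℝ) : ℂ) := by
  have h1 : w = w.re + w.im * Complex.I := (Complex.re_add_im w).symm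
  have h2 : conj w = w.re - w.im * Complex.I := by
    apply Complex.ext <;> simp
  rw [cassiniDelta, h2, sq_abs]
  conv_lhs => rw [h1]
  simp only [Complex.add_re, Complex.add_im, Complex.ofReal_re, Complex.ofReal_im,
    Complex.re_ofReal_mul, Complex.im_ofReal_mul, Complex.I_re, Complex.I_im]
  push_cast
  ring_nf
  rw [Complex.I_sq]
  ring

theorem setLength_cassini_level (w : ℂ) {r : ℝ} (hr : 0 < r) :
    setLength {z | cassiniDist z w = r} =
      ENNReal.ofReal (r ^ 2 * cassiniArcIntegral (|w.im| ^ 2) (r ^ 2)) := by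
  have hset : {z | cassiniDist z w = r} =
      {z : ℂ | ‖(z - w.re) ^ 2 + ((|w.im| ^ 2 : ℝ) : ℂ)‖ = r ^ 2} := by
    ext z
    rw [mem_ofPred_eq, mem_ofPred_eq, cassiniDist, cassiniDelta_eq,
      Real.sqrt_eq_iff_eq_sq (norm_nonneg _) hr.le]
  have ha : 0 ≤ |w.im| ^ 2 := by positivity
  have hs : 0 < r ^ 2 := by positivity
  have hpi : -Real.pi ≤ Real.pi := by linarith [Real.pi_pos]
  have hint := (intervalIntegrable_cassini ha hs).const_mul (r ^ 2)
  rw [intervalIntegrable_iff_integrableOn_Ioo_of_le hpi] at hint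
  rw [setLength, hset, hausdorffMeasure_level_set _ ha hs, cassiniArcIntegral,
    ← intervalIntegral.integral_const_mul, intervalIntegral.integral_of_le hpi,
    integral_Ioc_eq_integral_Ioo, ofReal_integral_eq_lintegral_ofReal hint]
  exact Eventually.of_forall fun θ => by beta_reduce; positivity

/-- Rationalizing the denominator: `r²` is the product of the sum and the difference of the two
roots. -/
theorem ofReal_level_div (w : ℂ) {r : ℝ} (hr : 0 < r) :
    ENNReal.ofReal (r ^ 2 * cassiniArcIntegral (|w.im| ^ 2) (r ^ 2)) /
      ENNReal.ofReal (2 * Real.pi * (√(r ^ 2 + |w.im| ^ 2) - |w.im|)) =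
    ENNReal.ofReal ((√(r ^ 2 + |w.im| ^ 2) + √(|w.im| ^ 2)) *
      cassiniArcIntegral (|w.im| ^ 2) (r ^ 2) / (2 * Real.pi)) := by
  have hlt : |w.im| < √(r ^ 2 + |w.im| ^ 2) :=
    Real.lt_sqrt_of_sq_lt (by linarith [pow_pos hr 2])
  have hpi := Real.pi_pos
  have hpos : 0 < √(r ^ 2 + |w.im| ^ 2) - |w.im| := sub_pos.2 hlt
  rw [← ENNReal.ofReal_div_of_pos (by positivity), Real.sqrt_sq (abs_nonneg _)]
  congr 1
  have hsq : √(r ^ 2 + |w.im| ^ 2) ^ 2 = r ^ 2 + |w.im| ^ 2 := Real.sq_sqrt (by positivity)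
  rw [div_eq_div_iff (by positivity) (by positivity)]
  linear_combination (-(2 * Real.pi) * cassiniArcIntegral (|w.im| ^ 2) (r ^ 2)) * hsq

theorem continuous_cassiniDist (w : ℂ) : Continuous fun z => cassiniDist z w := by
  unfold cassiniDist cassiniDelta
  fun_prop

theorem frontier_cassiniBall_subset (w : ℂ) (r : ℝ) :
    frontier (cassiniBall w r) ⊆ {z | cassiniDist z w = r} :=
  frontier_lt_subset_eq (continuous_cassiniDist w) continuous_const

theorem cassiniRatio_le (w : ℂ) {r : ℝ} (hr : 0 < r) :
    cassiniRatio w r ≤ ENNReal.ofReal lemniscateRatio := by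
  refine (ENNReal.div_le_div_right (measure_mono (frontier_cassiniBall_subset w r)) _).trans ?_
  have h := setLength_cassini_level w hr
  rw [setLength] at h
  rw [h, ofReal_level_div w hr]
  exact ENNReal.ofReal_le_ofReal (cassiniArcIntegral_mul_le (by positivity) (by positivity))

/-- With `X = ζ²` the hypothesis says `|X|² + 2a Re X = 0`, so scaling `X` by `l²` changes the
squared modulus from `a²` by `-l²(1-l²)|X|² < 0`. -/
theorem norm_real_mul_sq_add_lt {ζ : ℂ} {a l : ℝ} (ha : 0 < a) (hζ : ζ ≠ 0) (h : ‖ζ ^ 2 + a‖ = a)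
    (hl : l ∈ Ioo (0 : ℝ) 1) : ‖(l * ζ) ^ 2 + a‖ < a := by
  refine lt_of_pow_lt_pow_left₀ 2 ha.le ?_
  have h2 : ‖ζ ^ 2 + a‖ ^ 2 = a ^ 2 := by rw [h]
  rw [Complex.sq_norm, Complex.normSq_apply] at h2 ⊢
  have hpos : 0 < (ζ ^ 2).re * (ζ ^ 2).re + (ζ ^ 2).im * (ζ ^ 2).im := by
    rw [← Complex.normSq_apply]
    exact Complex.normSq_pos.2 (pow_ne_zero 2 hζ)
  rw [mul_pow, ← Complex.ofReal_pow]
  simp only [Complex.add_re, Complex.add_im, Complex.ofReal_re, Complex.ofReal_im,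
    Complex.re_ofReal_mul, Complex.im_ofReal_mul, add_zero] at h2 ⊢
  set x := (ζ ^ 2).re
  set y := (ζ ^ 2).im
  have hl2 : 0 < l ^ 2 := pow_pos hl.1 2
  have hl1 : l ^ 2 < 1 := pow_lt_one₀ hl.1.le hl.2 two_ne_zero
  have := mul_pos (mul_pos hl2 (sub_pos.2 hl1)) hpos
  nlinarith

theorem cassiniDist_lt_iff {z w : ℂ} {r : ℝ} (hr : 0 < r) :
    cassiniDist z w < r ↔ ‖(z - w.re) ^ 2 + ((|w.im| ^ 2 : ℝ) : ℂ)‖ < r ^ 2 := by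
  rw [cassiniDist, cassiniDelta_eq, Real.sqrt_lt' hr]

theorem frontier_cassiniBall_lemniscate {w : ℂ} (hw : w.im ≠ 0) :
    frontier (cassiniBall w |w.im|) = {z | cassiniDist z w = |w.im|} := by
  refine (frontier_cassiniBall_subset w _).antisymm fun z hz => ?_
  have hb : 0 < |w.im| := abs_pos.2 hw
  have ha : 0 < |w.im| ^ 2 := by positivity
  have hopen : IsOpen (cassiniBall w |w.im|) :=
    isOpen_lt (continuous_cassiniDist w) continuous_const
  rw [frontier, hopen.interior_eq]
  refine ⟨?_, fun h => (show cassiniDist z w < |w.im| from h).ne hz⟩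
  have hz' : ‖(z - w.re) ^ 2 + ((|w.im| ^ 2 : ℝ) : ℂ)‖ = |w.im| ^ 2 := by
    have h1 : cassiniDist z w = |w.im| := hz
    rwa [cassiniDist, cassiniDelta_eq, Real.sqrt_eq_iff_eq_sq (norm_nonneg _) hb.le] at h1
  rcases eq_or_ne (z - w.re) 0 with h0 | h0
  -- At the node, scaling about the centre fixes the point; it is approached instead along the focal
  -- axis, inside a lobe.
  · have hlim : Tendsto (fun d : ℝ => z + d * Complex.I) (𝓝[>] 0) (𝓝 z) := by
      have : Continuous fun d : ℝ => z + d * Complex.I := by fun_prop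
      simpa using (this.tendsto 0).mono_left (nhdsWithin_le_nhds (s := Ioi 0))
    refine mem_closure_of_tendsto hlim ?_
    filter_upwards [Ioo_mem_nhdsGT hb] with d hd
    refine (cassiniDist_lt_iff hb).2 ?_
    have e : (z + d * Complex.I - w.re) ^ 2 + ((|w.im| ^ 2 : ℝ) : ℂ) =
        ((|w.im| ^ 2 - d ^ 2 : ℝ) : ℂ) := by
      rw [add_sub_right_comm, h0]
      push_cast
      rw [zero_add, mul_pow, Complex.I_sq]
      ring
    have hdb : d ^ 2 < |w.im| ^ 2 := pow_lt_pow_left₀ hd.2 hd.1.le two_ne_zero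
    rw [e, Complex.norm_real, Real.norm_of_nonneg (by linarith)]
    linarith [pow_pos hd.1 2]
  -- Elsewhere, contraction towards the centre enters the open ball.
  · have hlim : Tendsto (fun l : ℝ => (w.re : ℂ) + l * (z - w.re)) (𝓝[<] 1) (𝓝 z) := by
      have : Continuous fun l : ℝ => (w.re : ℂ) + l * (z - w.re) := by fun_prop
      simpa using (this.tendsto 1).mono_left (nhdsWithin_le_nhds (s := Iio 1))
    refine mem_closure_of_tendsto hlim ?_
    filter_upwards [Ioo_mem_nhdsLT (zero_lt_one (α := ℝ))] with l hl
    refine (cassiniDist_lt_iff hb).2 ?_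
    rw [add_sub_cancel_left]
    exact norm_real_mul_sq_add_lt ha h0 hz' hl

theorem cassini_level_eq_bernoulliLemniscate (w : ℂ) :
    {z | cassiniDist z w = |w.im|} = bernoulliLemniscate w (conj w) := by
  ext z
  rw [bernoulliLemniscate, mem_ofPred_eq, mem_ofPred_eq, Complex.dist_self_conj, cassiniDist,
    cassiniDelta, Real.sqrt_eq_iff_eq_sq (norm_nonneg _) (abs_nonneg _), norm_mul, dist_eq_norm,
    dist_eq_norm, mul_div_cancel_left₀ _ (two_ne_zero' ℝ)]

theorem cassiniRatio_lemniscate {w : ℂ} (hw : w.im ≠ 0) :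
    cassiniRatio w |w.im| = ENNReal.ofReal lemniscateRatio := by
  have hb : 0 < |w.im| := abs_pos.2 hw
  rw [cassiniRatio, frontier_cassiniBall_lemniscate hw, setLength_cassini_level w hb,
    ofReal_level_div w hb, cassiniArcIntegral_self_mul (by positivity)]

theorem cassiniTheta_eq : cassiniTheta = ENNReal.ofReal lemniscateRatio := by
  refine le_antisymm (iSup_le fun w => iSup_le fun r => iSup_le fun hr => cassiniRatio_le w hr) ?_
  rw [← cassiniRatio_lemniscate (w := Complex.I) (by simp)]
  exact le_iSup_of_le Complex.I (le_iSup_of_le _ (le_iSup_of_le (by simp) le_rfl))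

theorem lemniscateRatio_nonneg : 0 ≤ lemniscateRatio := by
  unfold lemniscateRatio
  have := Real.pi_pos
  positivity

end CassiniRatio

theorem mainTheorem8 :
    cassiniTheta ≠ ⊤ ∧
    cassiniTheta.toReal =
      (1 + Real.sqrt 2) / 2 * (Real.Gamma (1 / 4) ^ 2 / Real.pi ^ (3 / 2 : ℝ)) ∧
    cassiniTheta.toReal < 2.85 ∧
    ∀ w : ℂ, w.im ≠ 0 →
      frontier (cassiniBall w |w.im|) = bernoulliLemniscate w (conj w) ∧
      cassiniRatio w |w.im| = cassiniTheta := by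
  have h : cassiniTheta.toReal = lemniscateRatio := by
    rw [cassiniTheta_eq, ENNReal.toReal_ofReal lemniscateRatio_nonneg]
  refine ⟨cassiniTheta_eq ▸ ENNReal.ofReal_ne_top, h, h ▸ lemniscate_constant_bound,
    fun w hw => ⟨?_, ?_⟩⟩
  · rw [frontier_cassiniBall_lemniscate hw, cassini_level_eq_bernoulliLemniscate]
  · rw [cassiniRatio_lemniscate hw, cassiniTheta_eq]
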